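/- Let $0<k<n$ be integers and let $G_{n,k}$ be the complex Grassmann manifold of $k$-dimensional complex subspaces $L\subset\mathbb{C}^n$, with its usual smooth structure, given by the charts $M_I=\{L : P^I(L)\neq 0\}$, $I\subset\{1,\dots,n\}$, $|I|=k$. Here $P^I(L)$ denotes the Plücker coordinates of $L$: the $k\times k$ minors, with rows $I$, of an $n\times k$ matrix whose columns form a basis of $L$; they are defined up to a common non-zero scalar. Let $\Lambda_I\in\mathbb{R}^n$ be the vector with $(\Lambda_I)_j=1$ for $j\in I$ and $(\Lambda_I)_j=0$ for $j\notin I$. Let $\Delta_{n,k}$ be the hypersimplex, the convex hull of all $\Lambda_I$, and let $\mathring{\Delta}_{n,k}$ be its relative interior. The moment map is $$\mu: G_{n,k}\to\Delta_{n,k}\subset\mathbb{R}^n,\qquad \mu(L)=\frac{\sum_I |P^I(L)|^2\Lambda_I}{\sum_I|P^I(L)|^2}.$$ A point $x\in\mathring{\Delta}_{n,k}$ is a regular value of $\mu$ if for every $L\in\mu^{-1}(x)$ the differential $d\mu(L)$ maps the tangent space of $G_{n,k}$ at $L$ onto the tangent space of $\mathring{\Delta}_{n,k}$, that is, onto the $(n-1)$-dimensional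 direction of the affine span of $\Delta_{n,k}$. For a set $\sigma$ of $k$-element subsets of $\{1,\dots,n\}$ let $W_\sigma=\{L\in G_{n,k} : P^I(L)\neq 0 \text{ for } I\in\sigma,\ P^I(L)=0 \text{ for } I\notin\sigma\}$. The non-empty sets $W_\sigma$ are called strata. The torus $(\mathbb{C}^*)^n$ acts on $G_{n,k}$ through its coordinatewise action on $\mathbb{C}^n$. The diagonal $\mathbb{C}^*$ acts trivially, so the quotient $(\mathbb{C}^*)^n/\mathbb{C}^*\cong(\mathbb{C}^*)^{n-1}$ acts on $G_{n,k}$. The stationary subgroup of a stratum $W_\sigma$ is the subgroup of $(\mathbb{C}^*)^n/\mathbb{C}^*$ of the elements that fix every point of $W_\sigma$ (all points of a stratum have the same stabilizer). The defect of $L\in G_{n,k}$ is the integer $q$ such that the orbit of $L$ under the compact torus $T^n\subset(\mathbb{C}^*)^n$ has dimension $n-1-q$. Theorem. Let $x\in\mathring{\Delta}_{n,k}$. (1) The point $x$ is a regular value of $\mu: G_{n,k}\to\Delta_{n,k}$ if and only if $\mu^{-1}(x)$ does not intersect any stratum whose stationary subgroup is non-trivial. (2) Equivalently, $x$ is a regular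 value of $\mu$ if and only if every point of $\mu^{-1}(x)$ has defect zero. -/

import Mathlib

open scoped Manifold ContDiff

noncomputable section

namespace TorusGrassmann

/-- The `k`-element subsets `I` of `{1, …, n}`. -/
abbrev KSubset (n k : ℕ) : Type := {I : Finset (Fin n) // I.card = k}

/-- The complex Grassmann manifold `G_{n,k}` of `k`-dimensional complex subspaces of `ℂ^n`. -/
def Gr (n k : ℕ) : Type := {L : Submodule ℂ (Fin n → ℂ) // Module.finrank ℂ L = k}

/-! ### Frames, Plücker coordinates -/

/-- `A` is an `n × k` matrix representing `L`: its columns span `L`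
(so that, as `dim L = k`, they form a basis of `L`). -/
def IsFrame {n k : ℕ} (A : Matrix (Fin n) (Fin k) ℂ) (L : Gr n k) : Prop :=
  LinearMap.range A.mulVecLin = L.1

/-- A matrix `A_L` representing `L`; its columns are a chosen basis of `L`. -/
def frame {n k : ℕ} (L : Gr n k) : Matrix (Fin n) (Fin k) ℂ :=
  Matrix.of fun i j => (Module.finBasisOfFinrankEq ℂ L.1 L.2 j : Fin n → ℂ) i

/-- The increasing enumeration of `I` followed by that of its complement. -/
def rowEquiv {n k : ℕ} (I : KSubset n k) : Fin k ⊕ Fin (n - k) ≃ Fin n :=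
  finSumEquivOfFinset I.2 (by rw [Finset.card_compl, I.2, Fintype.card_fin])

/-- The submatrix of the rows indexed by `I`. -/
def rowsIn {n k : ℕ} (I : KSubset n k) (A : Matrix (Fin n) (Fin k) ℂ) :
    Matrix (Fin k) (Fin k) ℂ :=
  A.submatrix (fun i => rowEquiv I (Sum.inl i)) id

/-- The submatrix of the rows indexed by the complement of `I`. -/
def rowsOut {n k : ℕ} (I : KSubset n k) (A : Matrix (Fin n) (Fin k) ℂ) :
    Matrix (Fin (n - k)) (Fin k) ℂ :=
  A.submatrix (fun i => rowEquiv I (Sum.inr i)) id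

/-- The `k × k` minor `P^I(A)` of `A` with rows `I`. -/
def minor {n k : ℕ} (I : KSubset n k) (A : Matrix (Fin n) (Fin k) ℂ) : ℂ :=
  (rowsIn I A).det

/-- The Plücker coordinates `P^I(L)`, for the chosen matrix `A_L`; another choice of the matrix
multiplies all of them by one non-zero scalar. -/
def plucker {n k : ℕ} (L : Gr n k) (I : KSubset n k) : ℂ :=
  minor I (frame L)

lemma frame_isFrame {n k : ℕ} (L : Gr n k) : IsFrame (frame L) L := by
  unfold IsFrame
  rw [Matrix.range_mulVecLin]
  set b := Module.finBasisOfFinrankEq ℂ L.1 L.2 with hb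
  have h : Set.range (frame L).col = L.1.subtype '' Set.range b := by
    rw [← Set.range_comp]
    rfl
  rw [h, Submodule.span_image, b.span_eq]
  simp

lemma IsFrame.mulVec_injective {n k : ℕ} {A : Matrix (Fin n) (Fin k) ℂ} {L : Gr n k}
    (hA : IsFrame A L) : Function.Injective A.mulVecLin := by
  have h1 := LinearMap.finrank_range_add_finrank_ker A.mulVecLin
  have h2 : Module.finrank ℂ (LinearMap.range A.mulVecLin) = k := by
    rw [show LinearMap.range A.mulVecLin = L.1 from hA]; exact L.2
  rw [h2, Module.finrank_fintype_fun_eq_card, Fintype.card_fin] at h1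
  exact LinearMap.ker_eq_bot.1 (Submodule.finrank_eq_zero.1 (by omega))

lemma range_mulVecLin_mul {n k : ℕ} (A : Matrix (Fin n) (Fin k) ℂ)
    {g : Matrix (Fin k) (Fin k) ℂ} (hg : IsUnit g.det) :
    LinearMap.range (A * g).mulVecLin = LinearMap.range A.mulVecLin := by
  rw [Matrix.mulVecLin_mul]
  apply LinearMap.range_comp_of_range_eq_top
  rw [LinearMap.range_eq_top]
  intro v
  exact ⟨g⁻¹.mulVec v, by simp [Matrix.mulVec_mulVec, Matrix.mul_nonsing_inv g hg]⟩

lemma IsFrame.exists_mul {n k : ℕ} {A B : Matrix (Fin n) (Fin k) ℂ} {L : Gr n k}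
    (hA : IsFrame A L) (hB : IsFrame B L) :
    ∃ g : Matrix (Fin k) (Fin k) ℂ, IsUnit g.det ∧ B = A * g := by
  have key : ∀ {C D : Matrix (Fin n) (Fin k) ℂ}, IsFrame C L → IsFrame D L →
      ∃ g : Matrix (Fin k) (Fin k) ℂ, D = C * g := by
    intro C D hC hD
    have h : ∀ j, ∃ v, C.mulVec v = D.col j := by
      intro j
      have : D.col j ∈ LinearMap.range C.mulVecLin := by
        rw [show LinearMap.range C.mulVecLin = L.1 from hC, ← show _ = L.1 from hD]
        exact ⟨Pi.single j 1, by simp⟩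
      exact this
    choose v hv using h
    refine ⟨Matrix.of fun i j => v j i, ?_⟩
    ext i j
    have := congrFun (hv j) i
    rw [← show D i j = D.col j i from rfl] at this
    rw [← this]
    rfl
  obtain ⟨g, hg⟩ := key hA hB
  obtain ⟨h, hh⟩ := key hB hA
  refine ⟨g, ?_, hg⟩
  have h1 : g * h = 1 := by
    have : A * (g * h) = A := by rw [← Matrix.mul_assoc, ← hg, ← hh]
    apply Matrix.toLin'.injective
    apply LinearMap.ext
    intro v
    apply hA.mulVec_injective
    simp [Matrix.mulVec_mulVec, this]
  exact (Matrix.isUnit_iff_isUnit_det g).1 (IsUnit.of_mul_eq_one h h1)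

lemma rowsIn_mul {n k : ℕ} (I : KSubset n k) (A : Matrix (Fin n) (Fin k) ℂ)
    (g : Matrix (Fin k) (Fin k) ℂ) : rowsIn I (A * g) = rowsIn I A * g := rfl

lemma rowsOut_mul {n k : ℕ} (I : KSubset n k) (A : Matrix (Fin n) (Fin k) ℂ)
    (g : Matrix (Fin k) (Fin k) ℂ) : rowsOut I (A * g) = rowsOut I A * g := rfl

lemma minor_mul {n k : ℕ} (I : KSubset n k) (A : Matrix (Fin n) (Fin k) ℂ)
    (g : Matrix (Fin k) (Fin k) ℂ) : minor I (A * g) = minor I A * g.det := by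
  rw [minor, rowsIn_mul, Matrix.det_mul, minor]

lemma IsFrame.plucker_eq {n k : ℕ} {A : Matrix (Fin n) (Fin k) ℂ} {L : Gr n k}
    (hA : IsFrame A L) : ∃ c : ℂ, c ≠ 0 ∧ ∀ I, plucker L I = c * minor I A := by
  obtain ⟨g, hg, h⟩ := hA.exists_mul (frame_isFrame L)
  exact ⟨g.det, hg.ne_zero, fun I => by rw [plucker, h, minor_mul, mul_comm]⟩

lemma exists_plucker_ne_zero {n k : ℕ} (L : Gr n k) : ∃ I, plucker L I ≠ 0 := by
  set A := frame L
  have hr : Module.finrank ℂ (Submodule.span ℂ (Set.range A.row)) = k := by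
    rw [← Matrix.rank_eq_finrank_span_row, Matrix.rank,
      show LinearMap.range A.mulVecLin = L.1 from frame_isFrame L]
    exact L.2
  obtain ⟨κ, a, ha, hs, hl⟩ := exists_linearIndependent' ℂ A.row
  have : Finite κ := Finite.of_injective a ha
  have := Fintype.ofFinite κ
  have hc : Fintype.card κ = k := by
    rw [← finrank_span_eq_card hl, hs, hr]
  let I : KSubset n k :=
    ⟨Finset.univ.map ⟨a, ha⟩, by rw [Finset.card_map, Finset.card_univ, hc]⟩
  have hm : ∀ i : Fin k, ∃ x, a x = rowEquiv I (Sum.inl i) := by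
    intro i
    have : rowEquiv I (Sum.inl i) ∈ I.1 := by
      rw [rowEquiv, finSumEquivOfFinset_inl]
      exact Finset.orderEmbOfFin_mem _ _ _
    simpa [I] using this
  choose f hf using hm
  have hfi : Function.Injective f := by
    intro i j h
    have : rowEquiv I (Sum.inl i) = rowEquiv I (Sum.inl j) := by rw [← hf, ← hf, h]
    simpa using this
  refine ⟨I, ?_⟩
  have hli : LinearIndependent ℂ (rowsIn I A).row := by
    have h := hl.comp f hfi
    have he : (rowsIn I A).row = (A.row ∘ a) ∘ f := by
      funext i
      change A.row (rowEquiv I (Sum.inl i)) = A.row (a (f i))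
      rw [hf]
    rw [he]
    exact h
  have hu := (Matrix.isUnit_iff_isUnit_det _).1 (Matrix.linearIndependent_rows_iff_isUnit.1 hli)
  exact hu.ne_zero

/-! ### The smooth structure given by the Plücker charts `M_I = {P^I ≠ 0}` -/

/-- The space `ℂ^{k(n-k)}` of the coordinates `a_{ij}`, `i ∉ I`. -/
abbrev Model (n k : ℕ) : Type := Fin (n - k) → Fin k → ℂ

/-- The `n × k` matrix with the identity in the rows `I` and `z` in the other rows. -/
def chartMatrix {n k : ℕ} (I : KSubset n k) (z : Model n k) : Matrix (Fin n) (Fin k) ℂ :=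
  Matrix.of fun i => Sum.elim (fun a => (1 : Matrix (Fin k) (Fin k) ℂ) a) z ((rowEquiv I).symm i)

/-- The coordinates of the subspace represented by `A`: the rows outside of `I` of the matrix
that represents the same subspace and has the identity in the rows `I`. -/
def coords {n k : ℕ} (I : KSubset n k) (A : Matrix (Fin n) (Fin k) ℂ) : Model n k :=
  rowsOut I A * (rowsIn I A)⁻¹

lemma rowsIn_chartMatrix {n k : ℕ} (I : KSubset n k) (z : Model n k) :
    rowsIn I (chartMatrix I z) = 1 := by
  ext i j
  simp [rowsIn, chartMatrix]

lemma rowsOut_chartMatrix {n k : ℕ} (I : KSubset n k) (z : Model n k) :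
    rowsOut I (chartMatrix I z) = z := by
  ext i j
  simp [rowsOut, chartMatrix]

lemma minor_chartMatrix {n k : ℕ} (I : KSubset n k) (z : Model n k) :
    minor I (chartMatrix I z) = 1 := by
  rw [minor, rowsIn_chartMatrix, Matrix.det_one]

lemma chartMatrix_coords {n k : ℕ} (I : KSubset n k) {A : Matrix (Fin n) (Fin k) ℂ}
    (hA : minor I A ≠ 0) : chartMatrix I (coords I A) = A * (rowsIn I A)⁻¹ := by
  have hu : IsUnit (rowsIn I A).det := isUnit_iff_ne_zero.2 hA
  ext i j
  obtain ⟨s, rfl⟩ := (rowEquiv I).surjective i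
  rcases s with a | b
  · have h := congrFun (congrFun (Matrix.mul_nonsing_inv _ hu) a) j
    rw [← rowsIn_mul] at h
    simpa [chartMatrix, rowsIn] using h.symm
  · simp only [chartMatrix, Matrix.of_apply, Equiv.symm_apply_apply, Sum.elim_inr]
    rfl

lemma coords_mul {n k : ℕ} (I : KSubset n k) (A : Matrix (Fin n) (Fin k) ℂ)
    {g : Matrix (Fin k) (Fin k) ℂ} (hg : IsUnit g.det) : coords I (A * g) = coords I A := by
  unfold coords
  rw [rowsOut_mul, rowsIn_mul, Matrix.mul_inv_rev, Matrix.mul_assoc, ← Matrix.mul_assoc g,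
    Matrix.mul_nonsing_inv g hg, Matrix.one_mul]

lemma finrank_range_chartMatrix {n k : ℕ} (I : KSubset n k) (z : Model n k) :
    Module.finrank ℂ (LinearMap.range (chartMatrix I z).mulVecLin) = k := by
  rw [LinearMap.finrank_range_of_inj, Module.finrank_fintype_fun_eq_card, Fintype.card_fin]
  intro v w h
  have h1 : ∀ u, (rowsIn I (chartMatrix I z)).mulVec u =
      fun i => (chartMatrix I z).mulVec u (rowEquiv I (Sum.inl i)) := fun u => rfl
  have h2 := h1 v
  rw [show (chartMatrix I z).mulVec v = (chartMatrix I z).mulVec w from h, ← h1 w,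
    rowsIn_chartMatrix, Matrix.one_mulVec, Matrix.one_mulVec] at h2
  exact h2

/-- The inverse `ℂ^{k(n-k)} → M_I` of the chart `u_I`. -/
def chartInv {n k : ℕ} (I : KSubset n k) (z : Model n k) : Gr n k :=
  ⟨LinearMap.range (chartMatrix I z).mulVecLin, finrank_range_chartMatrix I z⟩

lemma isFrame_chartInv {n k : ℕ} (I : KSubset n k) (z : Model n k) :
    IsFrame (chartMatrix I z) (chartInv I z) := rfl

lemma IsFrame.coords_eq {n k : ℕ} {A : Matrix (Fin n) (Fin k) ℂ} {L : Gr n k}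
    (hA : IsFrame A L) (I : KSubset n k) : coords I (frame L) = coords I A := by
  obtain ⟨g, hg, h⟩ := hA.exists_mul (frame_isFrame L)
  rw [h, coords_mul I A hg]

lemma IsFrame.plucker_ne_zero {n k : ℕ} {A : Matrix (Fin n) (Fin k) ℂ} {L : Gr n k}
    (hA : IsFrame A L) (I : KSubset n k) : plucker L I ≠ 0 ↔ minor I A ≠ 0 := by
  obtain ⟨c, hc, h⟩ := hA.plucker_eq
  rw [h]
  simp [hc]

/-- The chart `u_I : M_I → ℂ^{k(n-k)}`. -/
def chart {n k : ℕ} (I : KSubset n k) : PartialEquiv (Gr n k) (Model n k) where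
  toFun L := coords I (frame L)
  invFun := chartInv I
  source := {L | plucker L I ≠ 0}
  target := Set.univ
  map_source' _ _ := Set.mem_univ _
  map_target' z _ := by
    rw [Set.mem_ofPred_eq, (isFrame_chartInv I z).plucker_ne_zero, minor_chartMatrix]
    exact one_ne_zero
  left_inv' L hL := by
    apply Subtype.ext
    have hL' : minor I (frame L) ≠ 0 := hL
    change LinearMap.range (chartMatrix I (coords I (frame L))).mulVecLin = L.1
    rw [chartMatrix_coords I hL', range_mulVecLin_mul]
    · exact frame_isFrame L
    · rw [Matrix.isUnit_nonsing_inv_det_iff]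
      exact isUnit_iff_ne_zero.2 hL'
  right_inv' z _ := by
    rw [(isFrame_chartInv I z).coords_eq, coords, rowsIn_chartMatrix, rowsOut_chartMatrix,
      inv_one]
    exact Matrix.mul_one (z : Matrix (Fin (n - k)) (Fin k) ℂ)

lemma contDiff_det {E : Type*} [NormedAddCommGroup E] [NormedSpace ℝ E] {m : ℕ}
    {f : E → Matrix (Fin m) (Fin m) ℂ} (hf : ∀ i j, ContDiff ℝ ∞ fun z => f z i j) :
    ContDiff ℝ ∞ fun z => (f z).det := by
  simp only [Matrix.det_apply]
  refine ContDiff.sum fun σ _ => ?_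
  exact ContDiff.const_smul _ (contDiff_prod fun i _ => hf _ _)

lemma contDiff_chartMatrix {n k : ℕ} (I : KSubset n k) (i : Fin n) (j : Fin k) :
    ContDiff ℝ ∞ fun z : Model n k => chartMatrix I z i j := by
  obtain ⟨s, rfl⟩ := (rowEquiv I).surjective i
  rcases s with a | b
  · simp only [chartMatrix, Matrix.of_apply, Equiv.symm_apply_apply, Sum.elim_inl]
    exact contDiff_const
  · simp only [chartMatrix, Matrix.of_apply, Equiv.symm_apply_apply, Sum.elim_inr]
    fun_prop

lemma contDiff_minor_chartMatrix {n k : ℕ} (I J : KSubset n k) :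
    ContDiff ℝ ∞ fun z : Model n k => minor J (chartMatrix I z) :=
  contDiff_det fun _ _ => contDiff_chartMatrix I _ _

lemma chart_trans_source {n k : ℕ} (I J : KSubset n k) :
    ((chart I).symm.trans (chart J)).source = {z | minor J (chartMatrix I z) ≠ 0} := by
  ext z
  rw [PartialEquiv.trans_source]
  simp only [PartialEquiv.symm_source, Set.mem_inter_iff, Set.mem_preimage, Set.mem_ofPred_eq]
  rw [← (isFrame_chartInv I z).plucker_ne_zero]
  exact ⟨fun h => h.2, fun h => ⟨Set.mem_univ _, h⟩⟩

lemma chart_trans_apply {n k : ℕ} (I J : KSubset n k) (z : Model n k) :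
    ((chart I).symm.trans (chart J)) z = coords J (chartMatrix I z) :=
  (isFrame_chartInv I z).coords_eq J

lemma isOpen_chart_trans_source {n k : ℕ} (I J : KSubset n k) :
    IsOpen ((chart I).symm.trans (chart J)).source := by
  rw [chart_trans_source]
  exact isOpen_ne_fun (contDiff_minor_chartMatrix I J).continuous continuous_const

lemma contDiffOn_chart_trans {n k : ℕ} (I J : KSubset n k) :
    ContDiffOn ℝ ∞ ((chart I).symm.trans (chart J)) ((chart I).symm.trans (chart J)).source := by
  rw [chart_trans_source]
  have h : ((chart I).symm.trans (chart J) : Model n k → Model n k) =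
      fun z => coords J (chartMatrix I z) := funext (chart_trans_apply I J)
  rw [h, contDiffOn_pi]
  intro a
  rw [contDiffOn_pi]
  intro b
  change ContDiffOn ℝ ∞ (fun z => ∑ c, rowsOut J (chartMatrix I z) a c *
    (rowsIn J (chartMatrix I z))⁻¹ c b) _
  refine ContDiffOn.sum fun c _ => ?_
  refine ContDiffOn.mul (contDiff_chartMatrix I _ _).contDiffOn ?_
  have h2 : (fun z => (rowsIn J (chartMatrix I z))⁻¹ c b) = fun z =>
      (minor J (chartMatrix I z))⁻¹ * (rowsIn J (chartMatrix I z)).adjugate c b := by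
    funext z
    simp [Matrix.inv_def, minor]
  rw [h2]
  refine ContDiffOn.mul ((contDiff_minor_chartMatrix I J).contDiffOn.inv fun z hz => hz) ?_
  apply ContDiff.contDiffOn
  simp only [Matrix.adjugate_apply]
  refine contDiff_det fun i j => ?_
  by_cases hi : i = b
  · subst hi
    simp only [Matrix.updateRow_self]
    exact contDiff_const
  · simp only [Matrix.updateRow_ne hi]
    exact contDiff_chartMatrix I _ _

/-- The Plücker atlas of `G_{n,k}`. -/
def chartCore (n k : ℕ) : ChartedSpaceCore (Model n k) (Gr n k) where
  atlas := Set.range chart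
  chartAt L := chart (exists_plucker_ne_zero L).choose
  mem_chart_source L := (exists_plucker_ne_zero L).choose_spec
  chart_mem_atlas _ := Set.mem_range_self _
  open_source := by
    rintro _ _ ⟨I, rfl⟩ ⟨J, rfl⟩
    exact isOpen_chart_trans_source I J
  continuousOn_toFun := by
    rintro _ _ ⟨I, rfl⟩ ⟨J, rfl⟩
    exact (contDiffOn_chart_trans I J).continuousOn

instance (n k : ℕ) : TopologicalSpace (Gr n k) := (chartCore n k).toTopologicalSpace

instance (n k : ℕ) : ChartedSpace (Model n k) (Gr n k) := (chartCore n k).toChartedSpace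

/-- `G_{n,k}` is a (real) smooth manifold. -/
instance (n k : ℕ) : IsManifold 𝓘(ℝ, Model n k) ∞ (Gr n k) := by
  apply isManifold_of_contDiffOn
  rintro e e' he he'
  obtain ⟨c, hc⟩ := Set.mem_iUnion.1 he
  obtain ⟨⟨I, rfl⟩, rfl⟩ := Set.mem_iUnion.1 hc
  obtain ⟨c', hc'⟩ := Set.mem_iUnion.1 he'
  obtain ⟨⟨J, rfl⟩, rfl⟩ := Set.mem_iUnion.1 hc'
  exact (contDiffOn_chart_trans I J).mono fun z hz => hz.1

/-! ### The torus actions -/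

/-- The algebraic torus `(ℂ^*)^n`. -/
abbrev AlgTorus (n : ℕ) : Type := Fin n → ℂˣ

/-- The invertible diagonal map `(z_1, …, z_n) ↦ (t_1 z_1, …, t_n z_n)` of `ℂ^n`. -/
def diagMap {n : ℕ} (t : AlgTorus n) : (Fin n → ℂ) →ₗ[ℂ] (Fin n → ℂ) :=
  Matrix.toLin' (Matrix.diagonal fun i => (t i : ℂ))

lemma diagMap_apply {n : ℕ} (t : AlgTorus n) (v : Fin n → ℂ) (i : Fin n) :
    diagMap t v i = t i * v i := by
  simp [diagMap, Matrix.mulVec_diagonal]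

lemma diagMap_injective {n : ℕ} (t : AlgTorus n) : Function.Injective (diagMap t) := by
  intro v w h
  ext i
  have := congrFun h i
  simpa [diagMap_apply] using this

/-- The canonical action of `(ℂ^*)^n` on `G_{n,k}`. -/
instance (n k : ℕ) : MulAction (AlgTorus n) (Gr n k) where
  smul t L := ⟨L.1.map (diagMap t),
    (LinearEquiv.finrank_eq (Submodule.equivMapOfInjective _ (diagMap_injective t) L.1)).symm.trans
      L.2⟩
  one_smul L := by
    apply Subtype.ext
    change L.1.map (diagMap 1) = L.1
    have : diagMap (1 : AlgTorus n) = LinearMap.id := by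
      ext v i
      simp [diagMap_apply]
    rw [this, Submodule.map_id]
  mul_smul s t L := by
    apply Subtype.ext
    change L.1.map (diagMap (s * t)) = (L.1.map (diagMap t)).map (diagMap s)
    have : diagMap (s * t) = diagMap s ∘ₗ diagMap t := by
      apply LinearMap.ext
      intro v
      ext i
      simp [diagMap_apply, mul_assoc]
    rw [this, Submodule.map_comp]

/-- The diagonal `ℂ^* ⊂ (ℂ^*)^n`, which acts trivially on `G_{n,k}`. -/
def diagonalTorus (n : ℕ) : Subgroup (AlgTorus n) :=
  (Pi.constMonoidHom (Fin n) ℂˣ).range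

/-- The torus `(ℂ^*)^n / ℂ^* ≅ (ℂ^*)^{n-1}`, which acts effectively on `G_{n,k}`, `0 < k < n`. -/
abbrev EffTorus (n : ℕ) : Type := AlgTorus n ⧸ diagonalTorus n

lemma diagonalTorus_smul {n k : ℕ} {t : AlgTorus n} (ht : t ∈ diagonalTorus n) (L : Gr n k) :
    t • L = L := by
  obtain ⟨c, rfl⟩ := ht
  apply Subtype.ext
  change L.1.map (diagMap _) = L.1
  apply le_antisymm
  · rintro _ ⟨v, hv, rfl⟩
    have : diagMap (Pi.constMonoidHom (Fin n) ℂˣ c) v = (c : ℂ) • v := by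
      ext i
      simp [diagMap_apply]
    rw [this]
    exact L.1.smul_mem _ hv
  · intro v hv
    refine ⟨((c⁻¹ : ℂˣ) : ℂ) • v, L.1.smul_mem _ hv, ?_⟩
    ext i
    simp [diagMap_apply]

/-- The action of `(ℂ^*)^n / ℂ^*` on `G_{n,k}` as a homomorphism to the permutation group. -/
def effHom (n k : ℕ) : EffTorus n →* Equiv.Perm (Gr n k) :=
  QuotientGroup.lift (diagonalTorus n) (MulAction.toPermHom (AlgTorus n) (Gr n k)) (by
    intro t ht
    ext1 L
    exact diagonalTorus_smul ht L)

instance (n k : ℕ) : MulAction (EffTorus n) (Gr n k) :=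
  MulAction.compHom (Gr n k) (effHom n k)

/-- The compact torus element `(e^{iθ_1}, …, e^{iθ_n}) ∈ T^n ⊂ (ℂ^*)^n`. -/
def expTorus {n : ℕ} (θ : Fin n → ℝ) : AlgTorus n :=
  fun j => Circle.toUnits (Circle.exp (θ j))

/-- The dimension of the orbit `T^n · L` of the compact torus. The orbit is the image of the
map `θ ↦ e^{iθ} · L` of constant rank on the Lie algebra `ℝ^n` of `T^n`, and its tangent space
at `L` is the range of the differential of that map at `0`. -/
def orbitDim {n k : ℕ} (L : Gr n k) : ℕ :=
  Module.finrank ℝ (LinearMap.range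
    (mfderiv 𝓘(ℝ, Fin n → ℝ) 𝓘(ℝ, Model n k) (fun θ : Fin n → ℝ => expTorus θ • L) 0).toLinearMap)

/-- The defect `q` of `L`: `dim (T^n · L) = n - 1 - q`. -/
def defect {n k : ℕ} (L : Gr n k) : ℤ := (n : ℤ) - 1 - orbitDim L

/-! ### Strata -/

/-- `W_σ = {L | P^I(L) ≠ 0 for I ∈ σ, P^I(L) = 0 for I ∉ σ}`. -/
def stratum {n k : ℕ} (σ : Set (KSubset n k)) : Set (Gr n k) :=
  {L | ∀ I, plucker L I ≠ 0 ↔ I ∈ σ}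

/-- The index set `σ` is admissible, that is, the space `W_σ` is a stratum: it is not empty. -/
def IsAdmissible {n k : ℕ} (σ : Set (KSubset n k)) : Prop := (stratum σ).Nonempty

/-- The stationary subgroup of the stratum `W_σ` (the common stabilizer of its points) in the
torus `(ℂ^*)^n / ℂ^*`. -/
def stationarySubgroup {n k : ℕ} (σ : Set (KSubset n k)) : Subgroup (EffTorus n) :=
  fixingSubgroup (EffTorus n) (stratum σ)

/-! ### The moment map -/

/-- The weight vector `Λ_I ∈ ℝ^n`. -/
def weight {n k : ℕ} (I : KSubset n k) : Fin n → ℝ :=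
  fun j => if j ∈ I.1 then 1 else 0

/-- The hypersimplex `Δ_{n,k}`. -/
def hypersimplex (n k : ℕ) : Set (Fin n → ℝ) :=
  convexHull ℝ (Set.range (weight : KSubset n k → Fin n → ℝ))

/-- The moment map `μ : G_{n,k} → Δ_{n,k} ⊂ ℝ^n`,
`μ(L) = (∑_I |P^I(L)|² Λ_I) / (∑_I |P^I(L)|²)`. -/
def momentMap {n k : ℕ} (L : Gr n k) : Fin n → ℝ :=
  (∑ I, ‖plucker L I‖ ^ 2)⁻¹ • ∑ I, ‖plucker L I‖ ^ 2 • weight I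

/-- The moment map may be computed from any matrix that represents `L`. -/
lemma IsFrame.momentMap_eq {n k : ℕ} {A : Matrix (Fin n) (Fin k) ℂ} {L : Gr n k}
    (hA : IsFrame A L) :
    momentMap L = (∑ I, ‖minor I A‖ ^ 2)⁻¹ • ∑ I, ‖minor I A‖ ^ 2 • weight I := by
  obtain ⟨c, hc, h⟩ := hA.plucker_eq
  have hc' : ‖c‖ ^ 2 ≠ 0 := by simpa using hc
  simp only [momentMap, h, norm_mul, mul_pow, ← Finset.mul_sum, mul_smul, ← Finset.smul_sum]
  rw [smul_smul, mul_inv_rev, mul_assoc, inv_mul_cancel₀ hc', mul_one]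

/-- `L` is a regular point of `μ : G_{n,k} → Δ_{n,k}`: the differential of `μ` at `L` maps onto the
tangent space of `Δ_{n,k}`, the direction of the affine span of `Δ_{n,k}`. -/
def IsRegularPoint {n k : ℕ} (L : Gr n k) : Prop :=
  MDifferentiableAt 𝓘(ℝ, Model n k) 𝓘(ℝ, Fin n → ℝ) (momentMap : Gr n k → Fin n → ℝ) L ∧
    LinearMap.range (mfderiv 𝓘(ℝ, Model n k) 𝓘(ℝ, Fin n → ℝ)
      (momentMap : Gr n k → Fin n → ℝ) L).toLinearMap = vectorSpan ℝ (hypersimplex n k)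

/-- `x` is a regular value of `μ : G_{n,k} → Δ_{n,k}`: every point of `μ⁻¹(x)` is regular. -/
def IsRegularValue (n k : ℕ) (x : Fin n → ℝ) : Prop :=
  ∀ L : Gr n k, momentMap L = x → IsRegularPoint L

end TorusGrassmann

end

/-! In a chart `M_I`, attach to the coordinates `z` the bipartite graph between `I` and its
complement whose edges are the pairs with `z b j ≠ 0`. Triviality of the stationary subgroup, defect
zero and surjectivity of `dμ` are each equivalent, point by point, to the connectedness of this
graph, expressed by `IsConnected`: functions constant along edges are constant.

A torus element acts on `z b j` by the ratio of its two entries, so it fixes the point exactly when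
it is constant along edges (`smul_eq_iff`). Differentiating the compact action gives the same
condition on real vectors, and rank-nullity turns it into a statement about the defect
(`defect_eq_zero_iff`). The bridge to Plücker coordinates is `exists_exchange`: an edge is a
non-vanishing minor whose index set differs from `I` by one exchange.

For the moment map, `orthogonal_range_iff` identifies the annihilator of the image of `dμ`.
Differentiating `⟨θ, μ⟩` along the flow of `e^{sθ}` gives twice the variance of `θ(J) = ∑_{j ∈ J}
θ_j`, where `J` has probability proportional to `|P^J|²`. If `θ` annihilates the image, the variance
is zero, so `θ(J)` is the same for all `J` with `P^J ≠ 0`, and the exchanges make `θ` constant along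
edges. Conversely such a `θ` has constant `θ(J)` on these `J`, and the other `|P^J|²` have zero
derivative. The tangent space of the hypersimplex is the hyperplane of zero coordinate sum, so `dμ`
is onto exactly when only constant `θ` annihilate its image. -/

open scoped Manifold ContDiff

noncomputable section

namespace TorusGrassmann

variable {n k : ℕ}

/-! ### The torus action in a Plücker chart -/

/-- The weight `t^I = ∏_{i ∈ I} t_i`. -/
def torusWeight (t : AlgTorus n) (J : KSubset n k) : ℂ :=
  ∏ i : Fin k, (t (rowEquiv J (Sum.inl i)) : ℂ)

lemma rowEquiv_inl_mem (J : KSubset n k) (i : Fin k) : rowEquiv J (Sum.inl i) ∈ J.1 := by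
  rw [rowEquiv, finSumEquivOfFinset_inl]
  exact Finset.orderEmbOfFin_mem _ _ _

lemma image_rowEquiv_inl (J : KSubset n k) :
    Finset.univ.image (fun i => rowEquiv J (Sum.inl i)) = J.1 := by
  apply Finset.eq_of_subset_of_card_le
  · intro a ha
    obtain ⟨i, -, rfl⟩ := Finset.mem_image.1 ha
    exact rowEquiv_inl_mem J i
  · rw [Finset.card_image_of_injective, J.2, Finset.card_univ, Fintype.card_fin]
    exact (rowEquiv J).injective.comp Sum.inl_injective

lemma prod_rowEquiv_inl {M : Type*} [CommMonoid M] (J : KSubset n k) (f : Fin n → M) :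
    ∏ i : Fin k, f (rowEquiv J (Sum.inl i)) = ∏ j ∈ J.1, f j := by
  conv_rhs => rw [← image_rowEquiv_inl J]
  rw [Finset.prod_image]
  exact ((rowEquiv J).injective.comp Sum.inl_injective).injOn

lemma torusWeight_eq (t : AlgTorus n) (J : KSubset n k) :
    torusWeight t J = ∏ j ∈ J.1, (t j : ℂ) :=
  prod_rowEquiv_inl J fun j => (t j : ℂ)

lemma torusWeight_ne_zero (t : AlgTorus n) (J : KSubset n k) : torusWeight t J ≠ 0 :=
  Finset.prod_ne_zero_iff.2 fun _ _ => Units.ne_zero _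

/-- The matrix `diag(t) A`. -/
abbrev scaleRows (t : AlgTorus n) (A : Matrix (Fin n) (Fin k) ℂ) : Matrix (Fin n) (Fin k) ℂ :=
  Matrix.diagonal (fun i => (t i : ℂ)) * A

lemma minor_scaleRows (t : AlgTorus n) (J : KSubset n k) (A : Matrix (Fin n) (Fin k) ℂ) :
    minor J (scaleRows t A) = torusWeight t J * minor J A := by
  have h : rowsIn J (scaleRows t A) =
      Matrix.diagonal (fun i => (t (rowEquiv J (Sum.inl i)) : ℂ)) * rowsIn J A := by
    ext i j
    simp [rowsIn, scaleRows, Matrix.diagonal_mul]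
  rw [minor, h, Matrix.det_mul, Matrix.det_diagonal]
  rfl

/-- The action of the torus in the coordinates of the chart `M_I`. -/
def twist (I : KSubset n k) (t : AlgTorus n) (z : Model n k) : Model n k :=
  fun b j => (t (rowEquiv I (Sum.inr b)) : ℂ) * (t (rowEquiv I (Sum.inl j)) : ℂ)⁻¹ * z b j

/-- Scaling the rows spoils the identity block in the rows `I`; the right factor restores it by a
change of basis of the same subspace. -/
lemma scaleRows_chartMatrix (I : KSubset n k) (t : AlgTorus n) (z : Model n k) :
    scaleRows t (chartMatrix I z) = chartMatrix I (twist I t z) *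
      Matrix.diagonal (fun i => (t (rowEquiv I (Sum.inl i)) : ℂ)) := by
  ext i j
  obtain ⟨s, rfl⟩ := (rowEquiv I).surjective i
  rw [scaleRows, Matrix.diagonal_mul, Matrix.mul_diagonal]
  rcases s with a | b
  · simp only [chartMatrix, Matrix.of_apply, Equiv.symm_apply_apply, Sum.elim_inl]
    by_cases h : a = j
    · subst h
      simp
    · simp [Matrix.one_apply_ne h]
  · simp only [chartMatrix, Matrix.of_apply, Equiv.symm_apply_apply, Sum.elim_inr, twist]
    have := (t (rowEquiv I (Sum.inl j))).ne_zero
    field_simp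

lemma isUnit_det_diagonal (I : KSubset n k) (t : AlgTorus n) :
    IsUnit (Matrix.diagonal (fun i => (t (rowEquiv I (Sum.inl i)) : ℂ))).det := by
  rw [Matrix.det_diagonal]
  exact isUnit_iff_ne_zero.2 (torusWeight_ne_zero t I)

lemma smul_chartInv (I : KSubset n k) (t : AlgTorus n) (z : Model n k) :
    t • chartInv I z = chartInv I (twist I t z) := by
  apply Subtype.ext
  change (LinearMap.range (chartMatrix I z).mulVecLin).map (diagMap t) =
    LinearMap.range (chartMatrix I (twist I t z)).mulVecLin
  rw [← range_mulVecLin_mul (chartMatrix I (twist I t z)) (isUnit_det_diagonal I t), ← scaleRows_chartMatrix,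
    Matrix.mulVecLin_mul, LinearMap.range_comp]
  rfl

lemma minor_twist (I J : KSubset n k) (t : AlgTorus n) (z : Model n k) :
    minor J (chartMatrix I (twist I t z)) =
      torusWeight t J * (torusWeight t I)⁻¹ * minor J (chartMatrix I z) := by
  have h := minor_scaleRows t J (chartMatrix I z)
  rw [scaleRows_chartMatrix, minor_mul, Matrix.det_diagonal] at h
  change _ * torusWeight t I = _ at h
  have := torusWeight_ne_zero t I
  field_simp
  rw [h]

lemma chartInv_injective (I : KSubset n k) : Function.Injective (chartInv I) := by
  intro z w h
  have h1 := (chart I).right_inv (Set.mem_univ z)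
  have h2 := (chart I).right_inv (Set.mem_univ w)
  rw [← h1, ← h2]
  exact congrArg (chart I) h

/-- `minor` lists the rows in increasing order; any other enumeration of the same rows changes the
determinant only by a sign. -/
lemma minor_ne_zero_of_image {A : Matrix (Fin n) (Fin k) ℂ} {f : Fin k → Fin n}
    (hA : (A.submatrix f id).det ≠ 0) {J : KSubset n k}
    (hJ : J.1 = Finset.univ.image f) : minor J A ≠ 0 := by
  have h1 : ∀ i, ∃ a, f a = rowEquiv J (Sum.inl i) := by
    intro i
    have := rowEquiv_inl_mem J i
    rw [hJ] at this
    simpa using this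
  choose e he using h1
  have hinj : Function.Injective e := by
    intro i j h
    have : rowEquiv J (Sum.inl i) = rowEquiv J (Sum.inl j) := by rw [← he, ← he, h]
    simpa using this
  let σ : Equiv.Perm (Fin k) := Equiv.ofBijective e (Finite.injective_iff_bijective.1 hinj)
  have h2 : rowsIn J A = (A.submatrix f id).submatrix σ id := by
    ext i j
    change A _ _ = A (f (e i)) j
    rw [he]
    rfl
  rw [minor, h2, Matrix.det_permute]
  refine mul_ne_zero ?_ hA
  exact_mod_cast (Equiv.Perm.sign σ).ne_zero

/-- A non-zero coordinate of the chart `M_I` is, up to sign, a non-zero Plücker coordinate. -/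
lemma exists_exchange (I : KSubset n k) (z : Model n k) {b : Fin (n - k)} {j : Fin k}
    (h : z b j ≠ 0) :
    ∃ J : KSubset n k, minor J (chartMatrix I z) ≠ 0 ∧
      J.1 = insert (rowEquiv I (Sum.inr b)) (I.1.erase (rowEquiv I (Sum.inl j))) := by
  have hb : rowEquiv I (Sum.inr b) ∉ I.1 := by
    rw [← image_rowEquiv_inl I]
    simp
  set f : Fin k → Fin n :=
    Function.update (fun i => rowEquiv I (Sum.inl i)) j (rowEquiv I (Sum.inr b))
  have hfi : Function.Injective f := by
    intro x y hxy
    by_cases hx : x = j <;> by_cases hy : y = j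
    · rw [hx, hy]
    · subst hx; simp [f, Function.update_of_ne hy] at hxy
    · subst hy; simp [f, Function.update_of_ne hx] at hxy
    · simpa [f, Function.update_of_ne hx, Function.update_of_ne hy] using hxy
  have him : Finset.univ.image f =
      insert (rowEquiv I (Sum.inr b)) (I.1.erase (rowEquiv I (Sum.inl j))) := by
    apply Finset.eq_of_subset_of_card_le
    · intro a ha
      obtain ⟨i, -, rfl⟩ := Finset.mem_image.1 ha
      by_cases hi : i = j
      · subst hi; simp [f]
      · have := rowEquiv_inl_mem I i
        simp [f, this, hi]
    · rw [Finset.card_image_of_injective _ hfi, Finset.card_univ, Fintype.card_fin,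
        Finset.card_insert_of_notMem (fun h => hb (Finset.mem_of_mem_erase h)),
        Finset.card_erase_of_mem (rowEquiv_inl_mem I j), I.2]
      -- The new set has `k - 1 + 1` elements; the index `j` supplies `0 < k` for the truncated
      -- subtraction.
      have := j.pos
      omega
  refine ⟨⟨Finset.univ.image f, by simp [Finset.card_image_of_injective _ hfi]⟩, ?_, him⟩
  refine minor_ne_zero_of_image ?_ rfl
  -- Placing the new row at position `j`, not in sorted position, leaves an identity matrix with one
  -- row replaced; by Cramer its determinant is `z b j`.
  have hM : (chartMatrix I z).submatrix f id =
      (1 : Matrix (Fin k) (Fin k) ℂ).updateRow j (z b) := by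
    ext i l
    by_cases hi : i = j
    · subst hi; simp [f, chartMatrix]
    · simp [f, chartMatrix, Function.update_of_ne hi, Matrix.updateRow_ne hi]
  rw [hM, ← Matrix.cramer_transpose_apply]
  simpa using h

lemma sum_exchange {M : Type*} [AddCommGroup M] (I : KSubset n k) {b : Fin (n - k)} {j : Fin k}
    (f : Fin n → M) : ∑ i ∈ insert (rowEquiv I (Sum.inr b)) (I.1.erase (rowEquiv I (Sum.inl j))),
      f i = f (rowEquiv I (Sum.inr b)) - f (rowEquiv I (Sum.inl j)) + ∑ i ∈ I.1, f i := by
  have hb : rowEquiv I (Sum.inr b) ∉ I.1 := by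
    rw [← image_rowEquiv_inl I]
    simp
  rw [Finset.sum_insert (fun h => hb (Finset.mem_of_mem_erase h)),
    ← Finset.add_sum_erase _ _ (rowEquiv_inl_mem I j)]
  abel

lemma torusWeight_exchange (I J : KSubset n k) {b : Fin (n - k)} {j : Fin k}
    (hJ : J.1 = insert (rowEquiv I (Sum.inr b)) (I.1.erase (rowEquiv I (Sum.inl j))))
    (t : AlgTorus n) (h : torusWeight t J = torusWeight t I) :
    t (rowEquiv I (Sum.inr b)) = t (rowEquiv I (Sum.inl j)) := by
  have hb : rowEquiv I (Sum.inr b) ∉ I.1 := by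
    rw [← image_rowEquiv_inl I]
    simp
  rw [torusWeight_eq, torusWeight_eq, hJ,
    Finset.prod_insert (fun h => hb (Finset.mem_of_mem_erase h)),
    ← Finset.mul_prod_erase _ _ (rowEquiv_inl_mem I j)] at h
  exact Units.ext (mul_right_cancel₀ (Finset.prod_ne_zero_iff.2 fun _ _ => Units.ne_zero _) h)

/-! ### Stationary subgroups -/

/-- `f` is constant along the edges of the bipartite graph of the non-zero coordinates `z`. -/
def IsCompatible {M : Type*} (I : KSubset n k) (z : Model n k) (f : Fin n → M) : Prop :=
  ∀ b j, z b j ≠ 0 → f (rowEquiv I (Sum.inr b)) = f (rowEquiv I (Sum.inl j))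

/-- Every real function on `{1, …, n}` that is compatible with `z` is constant. -/
def IsConnected (I : KSubset n k) (z : Model n k) : Prop :=
  ∀ θ : Fin n → ℝ, IsCompatible I z θ → ∀ i j, θ i = θ j

lemma IsCompatible.twist_eq {I : KSubset n k} {z : Model n k} {t : AlgTorus n}
    (h : IsCompatible I z t) : twist I t z = z := by
  funext b j
  by_cases hz : z b j = 0
  · simp [twist, hz]
  · simp [twist, h b j hz]

lemma isCompatible_of_torusWeight {I : KSubset n k} {z : Model n k} {t : AlgTorus n}
    (h : ∀ J, minor J (chartMatrix I z) ≠ 0 → torusWeight t J = torusWeight t I) :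
    IsCompatible I z t := by
  intro b j hz
  obtain ⟨J, hJ, hJ'⟩ := exists_exchange I z hz
  exact torusWeight_exchange I J hJ' t (h J hJ)

/-- By `minor_twist` the action multiplies the minor `J` by `t^J / t^I`; at a fixed point a non-zero
minor forces this factor to be 1. -/
lemma torusWeight_eq_of_twist_eq {I : KSubset n k} {z : Model n k} {t : AlgTorus n}
    (h : twist I t z = z) (J : KSubset n k) (hJ : minor J (chartMatrix I z) ≠ 0) :
    torusWeight t J = torusWeight t I := by
  have h1 := minor_twist I J t z
  rw [h] at h1
  have := torusWeight_ne_zero t I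
  field_simp at h1
  exact h1.symm

lemma exists_chartInv_eq {I : KSubset n k} {L : Gr n k} (h : plucker L I ≠ 0) :
    chartInv I (coords I (frame L)) = L :=
  (chart I).left_inv h

lemma smul_eq_iff {I : KSubset n k} {z : Model n k} {t : AlgTorus n} :
    t • chartInv I z = chartInv I z ↔ IsCompatible I z t := by
  rw [smul_chartInv]
  exact ⟨fun h => isCompatible_of_torusWeight
    (torusWeight_eq_of_twist_eq (chartInv_injective I h)), fun h => by rw [h.twist_eq]⟩

/-- All points of a stratum have the same stabilizer. -/
lemma smul_eq_of_mem_stratum {σ : Set (KSubset n k)} {L L' : Gr n k} (hL : L ∈ stratum σ)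
    (hL' : L' ∈ stratum σ) {t : AlgTorus n} (h : t • L = L) : t • L' = L' := by
  obtain ⟨I, hI⟩ := exists_plucker_ne_zero L
  have hI' := (hL' I).2 ((hL I).1 hI)
  rw [← exists_chartInv_eq hI] at h hL
  rw [← exists_chartInv_eq hI'] at hL' ⊢
  rw [smul_chartInv] at h
  rw [smul_eq_iff]
  apply isCompatible_of_torusWeight
  intro J hJ
  -- The fixing criterion sees only which Plücker coordinates are non-zero, and these are the same
  -- for both points.
  rw [← (isFrame_chartInv _ _).plucker_ne_zero, hL', ← hL,
    (isFrame_chartInv _ _).plucker_ne_zero] at hJ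
  exact torusWeight_eq_of_twist_eq (chartInv_injective I h) J hJ

lemma mem_diagonalTorus_iff (hn : 0 < n) {t : AlgTorus n} :
    t ∈ diagonalTorus n ↔ ∀ i j, t i = t j := by
  constructor
  · rintro ⟨c, rfl⟩ i j
    rfl
  · intro h
    exact ⟨t ⟨0, hn⟩, funext fun i => h _ _⟩

/-- Compatibility depends only on the level sets of a function. A non-constant compatible function
therefore yields a two-valued one with values in any other set: 0 and 1 in `ℝ`, or 1 and -1 in `ℂˣ`.
-/
lemma isConnected_iff_torus {I : KSubset n k} {z : Model n k} :
    IsConnected I z ↔ ∀ t : AlgTorus n, IsCompatible I z t → ∀ i j, t i = t j := by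
  classical
  constructor
  · intro h t ht i j
    have := h (fun l => if t l = t j then 1 else 0) (fun b l hz => by simp only [ht b l hz]) i j
    by_contra hne
    simp [hne] at this
  · intro h θ hθ i j
    have := h (fun l => if θ l = θ j then 1 else -1) (fun b l hz => by simp only [hθ b l hz]) i j
    by_contra hne
    simp only [hne, if_true, if_false] at this
    have h2 := congrArg Units.val this
    norm_num at h2

lemma mem_stationarySubgroup_mk {σ : Set (KSubset n k)} {t : AlgTorus n} :
    (QuotientGroup.mk t : EffTorus n) ∈ stationarySubgroup σ ↔
      ∀ L ∈ stratum σ, t • L = L := by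
  rw [stationarySubgroup, mem_fixingSubgroup_iff]
  rfl

/-- One point decides: stabilizers agree along a stratum, and trivial elements of the quotient torus
are the classes of constant tuples. -/
lemma stationarySubgroup_eq_bot_iff (hn : 0 < n) {σ : Set (KSubset n k)} {I : KSubset n k}
    {z : Model n k} (h : chartInv I z ∈ stratum σ) :
    stationarySubgroup σ = ⊥ ↔ IsConnected I z := by
  rw [isConnected_iff_torus, Subgroup.eq_bot_iff_forall]
  constructor
  · intro h1 t ht
    rw [← mem_diagonalTorus_iff hn, ← QuotientGroup.eq_one_iff]
    exact h1 _ (mem_stationarySubgroup_mk.2 fun L hL =>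
      smul_eq_of_mem_stratum h hL (smul_eq_iff.2 ht))
  · intro h1 t ht
    induction t using QuotientGroup.induction_on with
    | H t =>
      rw [QuotientGroup.eq_one_iff, mem_diagonalTorus_iff hn]
      exact h1 t (smul_eq_iff.1 (mem_stationarySubgroup_mk.1 ht _ h))

/-! ### The orbit map of the compact torus -/

/-- The index of the preferred chart at `L`. -/
def chartIndex (L : Gr n k) : KSubset n k := (exists_plucker_ne_zero L).choose

lemma plucker_chartIndex (L : Gr n k) : plucker L (chartIndex L) ≠ 0 :=
  (exists_plucker_ne_zero L).choose_spec

/-- The coordinates of `L` in the preferred chart at `L`. -/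
def localCoords (L : Gr n k) : Model n k := coords (chartIndex L) (frame L)

lemma chartInv_localCoords (L : Gr n k) : chartInv (chartIndex L) (localCoords L) = L :=
  exists_chartInv_eq (plucker_chartIndex L)

lemma coords_chartInv (I : KSubset n k) (z : Model n k) : coords I (frame (chartInv I z)) = z :=
  (chart I).right_inv (Set.mem_univ z)

/-- The chart is onto the whole model space, so continuity of its inverse on the target is global.
-/
lemma continuous_chartInv_chartIndex (L : Gr n k) : Continuous (chartInv (chartIndex L)) := by
  have h := (chartAt (Model n k) L).continuousOn_symm
  exact continuousOn_univ.1 h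

/-- The derivative at `0` of the orbit map `θ ↦ e^{iθ} · L` in the chart `M_I`. -/
def orbitDeriv (I : KSubset n k) (z : Model n k) : (Fin n → ℝ) →L[ℝ] Model n k :=
  ContinuousLinearMap.pi fun b => ContinuousLinearMap.pi fun j =>
    (ContinuousLinearMap.proj (R := ℝ) (φ := fun _ : Fin n => ℝ) (rowEquiv I (Sum.inr b)) -
      ContinuousLinearMap.proj (rowEquiv I (Sum.inl j))).smulRight (Complex.I * z b j)

lemma orbitDeriv_apply (I : KSubset n k) (z : Model n k) (θ : Fin n → ℝ) (b : Fin (n - k))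
    (j : Fin k) : orbitDeriv I z θ b j =
      (θ (rowEquiv I (Sum.inr b)) - θ (rowEquiv I (Sum.inl j))) • (Complex.I * z b j) := rfl

lemma orbitDeriv_eq_zero_iff (I : KSubset n k) (z : Model n k) (θ : Fin n → ℝ) :
    orbitDeriv I z θ = 0 ↔ IsCompatible I z θ := by
  constructor
  · intro h b j hz
    have h1 := congrFun (congrFun h b) j
    rw [orbitDeriv_apply] at h1
    simpa [hz, sub_eq_zero] using h1
  · intro h
    funext b j
    rw [orbitDeriv_apply]
    by_cases hz : z b j = 0
    · simp [hz]
    · simp [h b j hz]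

lemma expTorus_apply (θ : Fin n → ℝ) (i : Fin n) :
    (expTorus θ i : ℂ) = Complex.exp (θ i * Complex.I) := by
  simp [expTorus, Circle.coe_exp]

lemma twist_expTorus (I : KSubset n k) (z : Model n k) (θ : Fin n → ℝ) (b : Fin (n - k))
    (j : Fin k) : twist I (expTorus θ) z b j = Complex.exp
      (((θ (rowEquiv I (Sum.inr b)) - θ (rowEquiv I (Sum.inl j)) : ℝ) : ℂ) * Complex.I) *
        z b j := by
  rw [twist, expTorus_apply, expTorus_apply, ← Complex.exp_neg, ← Complex.exp_add]
  congr 2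
  push_cast
  ring

lemma hasFDerivAt_twist_expTorus (I : KSubset n k) (z : Model n k) :
    HasFDerivAt (fun θ : Fin n → ℝ => twist I (expTorus θ) z) (orbitDeriv I z) 0 := by
  refine hasFDerivAt_pi'.2 fun b => hasFDerivAt_pi'.2 fun j => ?_
  simp only [twist_expTorus]
  have h1 : HasFDerivAt (fun θ : Fin n → ℝ =>
      θ (rowEquiv I (Sum.inr b)) - θ (rowEquiv I (Sum.inl j)))
      (ContinuousLinearMap.proj (R := ℝ) (φ := fun _ : Fin n => ℝ) (rowEquiv I (Sum.inr b)) -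
        ContinuousLinearMap.proj (rowEquiv I (Sum.inl j))) 0 :=
    (hasFDerivAt_apply _ _).sub (hasFDerivAt_apply _ _)
  have h2 : HasDerivAt (fun s : ℝ => Complex.exp ((s : ℂ) * Complex.I) * z b j)
      (Complex.I * z b j) 0 := by
    have h0 : HasDerivAt (fun s : ℝ => (s : ℂ) * Complex.I) (1 * Complex.I) 0 :=
      (Complex.ofRealCLM.hasDerivAt).mul_const _
    simpa using h0.cexp.mul_const (z b j)
  have h3 : HasFDerivAt (fun s : ℝ => Complex.exp ((s : ℂ) * Complex.I) * z b j)
      (ContinuousLinearMap.toSpanSingleton ℝ (Complex.I * z b j))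
      ((0 : Fin n → ℝ) (rowEquiv I (Sum.inr b)) - (0 : Fin n → ℝ) (rowEquiv I (Sum.inl j))) := by
    simpa using h2.hasFDerivAt
  exact HasFDerivAt.comp (g := fun s : ℝ => Complex.exp ((s : ℂ) * Complex.I) * z b j)
    (0 : Fin n → ℝ) h3 h1

lemma mfderiv_orbit (L : Gr n k) :
    mfderiv 𝓘(ℝ, Fin n → ℝ) 𝓘(ℝ, Model n k) (fun θ : Fin n → ℝ => expTorus θ • L) 0 =
      orbitDeriv (chartIndex L) (localCoords L) := by
  have hz : expTorus (0 : Fin n → ℝ) • L = L := by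
    have : expTorus (0 : Fin n → ℝ) = 1 := by
      funext i
      apply Units.ext
      simp [expTorus_apply]
    rw [this, one_smul]
  have hf : (fun θ : Fin n → ℝ => expTorus θ • L) =
      fun θ => chartInv (chartIndex L) (twist (chartIndex L) (expTorus θ) (localCoords L)) := by
    funext θ
    rw [← smul_chartInv, chartInv_localCoords]
  have hd := hasFDerivAt_twist_expTorus (chartIndex L) (localCoords L)
  have hw : writtenInExtChartAt 𝓘(ℝ, Fin n → ℝ) 𝓘(ℝ, Model n k) 0
      (fun θ : Fin n → ℝ => expTorus θ • L) =
      fun θ => twist (chartIndex L) (expTorus θ) (localCoords L) := by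
    funext θ
    -- The manifold derivative uses the chart preferred at the value at `θ = 0`; that value is `L`
    -- only after rewriting.
    change coords (chartIndex (expTorus (0 : Fin n → ℝ) • L)) (frame (expTorus θ • L)) = _
    rw [hz, congrFun hf θ, coords_chartInv]
  have hm : HasMFDerivAt 𝓘(ℝ, Fin n → ℝ) 𝓘(ℝ, Model n k)
      (fun θ : Fin n → ℝ => expTorus θ • L) 0 (orbitDeriv (chartIndex L) (localCoords L)) := by
    refine ⟨?_, ?_⟩
    · rw [hf]
      exact (continuous_chartInv_chartIndex L).continuousAt.comp hd.continuousAt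
    · rw [hw]
      exact hd.hasFDerivWithinAt
  exact hm.mfderiv

/-- By rank-nullity the defect is the dimension of the kernel of the orbit differential minus 1. The
kernel consists of the compatible vectors and always contains `(1, …, 1)`. -/
lemma defect_eq_zero_iff (hn : 0 < n) (L : Gr n k) :
    defect L = 0 ↔ IsConnected (chartIndex L) (localCoords L) := by
  have : NeZero n := ⟨hn.ne'⟩
  set D := orbitDeriv (chartIndex L) (localCoords L)
  have h1 : orbitDim L = Module.finrank ℝ (LinearMap.range D.toLinearMap) := by
    rw [orbitDim, mfderiv_orbit]
    rfl
  have h2 := LinearMap.finrank_range_add_finrank_ker D.toLinearMap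
  rw [Module.finrank_fintype_fun_eq_card, Fintype.card_fin] at h2
  have h3 : defect L = 0 ↔ Module.finrank ℝ (LinearMap.ker D.toLinearMap) = 1 := by
    rw [defect, h1]
    omega
  have hmem : ∀ θ, θ ∈ LinearMap.ker D.toLinearMap ↔
      IsCompatible (chartIndex L) (localCoords L) θ :=
    fun θ => orbitDeriv_eq_zero_iff _ _ θ
  let u : LinearMap.ker D.toLinearMap := ⟨fun _ => 1, (hmem _).2 fun _ _ _ => rfl⟩
  have hu : u ≠ 0 := by
    intro h
    have := congrFun (congrArg Subtype.val h) 0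
    simp [u] at this
  rw [h3, finrank_eq_one_iff_of_nonzero' u hu]
  constructor
  · intro h θ hθ i j
    obtain ⟨c, hc⟩ := h ⟨θ, (hmem θ).2 hθ⟩
    have hc' : ∀ i, c * 1 = θ i := fun i => congrFun (congrArg Subtype.val hc) i
    rw [← hc' i, ← hc' j]
  · rintro h ⟨θ, hθ⟩
    refine ⟨θ 0, Subtype.ext (funext fun i => ?_)⟩
    change θ 0 * 1 = θ i
    rw [mul_one]
    exact h θ ((hmem θ).1 hθ) _ _

/-! ### The affine span of the hypersimplex -/

/-- The sum `∑_{i ∈ I} θ_i`, which is the pairing of `θ` with `Λ_I`. -/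
def indexSum (θ : Fin n → ℝ) (J : KSubset n k) : ℝ := ∑ j ∈ J.1, θ j

lemma sum_mul_weight (θ : Fin n → ℝ) (J : KSubset n k) :
    ∑ i, θ i * weight J i = indexSum θ J := by
  simp [weight, indexSum, Finset.sum_ite_mem]

lemma sum_weight (J : KSubset n k) : ∑ i, weight J i = k := by
  simp [weight, J.2]

lemma weight_sub_weight_mem (J J' : KSubset n k) :
    weight J - weight J' ∈ vectorSpan ℝ (hypersimplex n k) :=
  vsub_mem_vectorSpan ℝ (subset_convexHull ℝ _ (Set.mem_range_self J))
    (subset_convexHull ℝ _ (Set.mem_range_self J'))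

/-- The hyperplane of the vectors with vanishing sum of the coordinates. -/
def sumZero (n : ℕ) : Submodule ℝ (Fin n → ℝ) where
  carrier := {v | ∑ i, v i = 0}
  add_mem' {v w} hv hw := by
    have hv' : ∑ i, v i = 0 := hv
    have hw' : ∑ i, w i = 0 := hw
    simp [Finset.sum_add_distrib, hv', hw']
  zero_mem' := by simp
  smul_mem' c v hv := by
    have hv' : ∑ i, v i = 0 := hv
    simp [← Finset.mul_sum, hv']

lemma mem_sumZero {v : Fin n → ℝ} : v ∈ sumZero n ↔ ∑ i, v i = 0 := Iff.rfl

lemma vectorSpan_hypersimplex_le : vectorSpan ℝ (hypersimplex n k) ≤ sumZero n := by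
  have h : hypersimplex n k ⊆ {v | ∑ i, v i = (k : ℝ)} := by
    refine convexHull_min ?_ ?_
    · rintro _ ⟨J, rfl⟩
      exact sum_weight J
    · refine convex_hyperplane (f := fun v : Fin n → ℝ => ∑ i, v i) ⟨?_, ?_⟩ (k : ℝ)
      · intro v w
        simp [Finset.sum_add_distrib]
      · intro c v
        simp [Finset.mul_sum]
  rw [vectorSpan_def, Submodule.span_le]
  rintro _ ⟨v, hv, w, hw, rfl⟩
  have hv' : ∑ i, v i = (k : ℝ) := h hv
  have hw' : ∑ i, w i = (k : ℝ) := h hw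
  change ∑ i, (v - w) i = 0
  simp [Finset.sum_sub_distrib, hv', hw']

/-- A linear form that is constant on the hypersimplex has equal coefficients. -/
lemma eq_of_indexSum_eq (hk : 0 < k) (hkn : k < n) {θ : Fin n → ℝ}
    (h : ∀ J J' : KSubset n k, indexSum θ J = indexSum θ J') (a b : Fin n) : θ a = θ b := by
  by_cases hab : a = b
  · rw [hab]
  -- As `k - 1 ≤ n - 2`, there is room for a set avoiding `a` and `b`; completing it by either one
  -- gives two vertices whose pairings with `θ` differ by `θ a - θ b`.
  obtain ⟨S, hS, hS'⟩ := Finset.exists_subset_card_eq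
    (s := (Finset.univ.erase a).erase b) (n := k - 1) (by
      rw [Finset.card_erase_of_mem (by simp [Ne.symm hab]), Finset.card_erase_of_mem (by simp),
        Finset.card_univ, Fintype.card_fin]
      omega)
  have ha : a ∉ S := fun h => by simpa using hS h
  have hb : b ∉ S := fun h => by simpa using hS h
  have h1 := h ⟨insert a S, by rw [Finset.card_insert_of_notMem ha, hS']; omega⟩
    ⟨insert b S, by rw [Finset.card_insert_of_notMem hb, hS']; omega⟩
  simpa [indexSum, Finset.sum_insert ha, Finset.sum_insert hb] using h1

lemma linearMap_apply_eq_sum (f : (Fin n → ℝ) →ₗ[ℝ] ℝ) (v : Fin n → ℝ) :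
    f v = ∑ i, f (Pi.single i 1) * v i := by
  conv_lhs => rw [pi_eq_sum_univ' v]
  simp [map_sum, mul_comm]

/-- A space of vectors with vanishing sum of coordinates is the whole hyperplane if and only if
only the multiples of `(1, …, 1)` are orthogonal to it. -/
lemma eq_sumZero_iff {W : Submodule ℝ (Fin n → ℝ)} (hW : W ≤ sumZero n) :
    W = sumZero n ↔ ∀ θ : Fin n → ℝ, (∀ v ∈ W, ∑ i, θ i * v i = 0) → ∀ i j, θ i = θ j := by
  constructor
  · rintro rfl θ hθ i j
    have h1 := hθ (Pi.single i 1 - Pi.single j 1) (by simp [mem_sumZero, Finset.sum_sub_distrib])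
    simpa [mul_sub, Finset.sum_sub_distrib, Pi.single_apply, sub_eq_zero] using h1
  · intro h
    refine le_antisymm hW fun v hv => ?_
    by_contra hvW
    -- A functional vanishing on `W` but not at `v` would have equal coefficients, hence be a
    -- multiple of the coordinate sum, which kills `v`.
    obtain ⟨f, hf, hf'⟩ := Submodule.exists_le_ker_of_notMem hvW
    apply hf
    have hc := h (fun i => f (Pi.single i 1)) fun w hw => by
      rw [← linearMap_apply_eq_sum]
      exact hf' hw
    rw [linearMap_apply_eq_sum]
    rcases Nat.eq_zero_or_pos n with rfl | hn
    · simp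
    · simp only [fun i => hc i ⟨0, hn⟩]
      rw [← Finset.mul_sum, mem_sumZero.1 hv, mul_zero]

lemma vectorSpan_hypersimplex (hk : 0 < k) (hkn : k < n) :
    vectorSpan ℝ (hypersimplex n k) = sumZero n := by
  refine (eq_sumZero_iff vectorSpan_hypersimplex_le).2 fun θ hθ => ?_
  apply eq_of_indexSum_eq hk hkn
  intro J J'
  have h1 := hθ _ (weight_sub_weight_mem J J')
  simp only [Pi.sub_apply, mul_sub, Finset.sum_sub_distrib, sum_mul_weight] at h1
  linarith

/-! ### The moment map in a Plücker chart -/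

/-- `|P^J|²` in the chart `M_I`. -/
def normSqMinor (I J : KSubset n k) (z : Model n k) : ℝ := ‖minor J (chartMatrix I z)‖ ^ 2

/-- The moment map in the chart `M_I`. -/
def localMoment (I : KSubset n k) (z : Model n k) : Fin n → ℝ :=
  (∑ J, normSqMinor I J z)⁻¹ • ∑ J, normSqMinor I J z • weight J

lemma momentMap_chartInv (I : KSubset n k) (z : Model n k) :
    momentMap (chartInv I z) = localMoment I z :=
  (isFrame_chartInv I z).momentMap_eq

lemma normSqMinor_nonneg (I J : KSubset n k) (z : Model n k) : 0 ≤ normSqMinor I J z := by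
  unfold normSqMinor
  positivity

lemma sum_normSqMinor_pos (I : KSubset n k) (z : Model n k) : 0 < ∑ J, normSqMinor I J z := by
  refine Finset.sum_pos' (fun J _ => normSqMinor_nonneg I J z) ⟨I, Finset.mem_univ _, ?_⟩
  simp [normSqMinor, minor_chartMatrix]

lemma differentiable_normSqMinor (I J : KSubset n k) : Differentiable ℝ (normSqMinor I J) :=
  ((contDiff_minor_chartMatrix I J).norm_sq ℝ).differentiable (by simp)

lemma differentiable_localMoment (I : KSubset n k) : Differentiable ℝ (localMoment I) := by
  have h1 : Differentiable ℝ fun z => ∑ J, normSqMinor I J z :=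
    Differentiable.fun_sum fun J _ => differentiable_normSqMinor I J
  have h2 : Differentiable ℝ fun z => ∑ J, normSqMinor I J z • weight J :=
    Differentiable.fun_sum fun J _ => (differentiable_normSqMinor I J).smul_const _
  exact (h1.inv fun z => (sum_normSqMinor_pos I z).ne').smul h2

/-- The pairing of `μ` with `θ`. -/
lemma sum_mul_localMoment (I : KSubset n k) (z : Model n k) (θ : Fin n → ℝ) :
    (∑ J, normSqMinor I J z) * ∑ i, θ i * localMoment I z i =
      ∑ J, normSqMinor I J z * indexSum θ J := by
  have h := (sum_normSqMinor_pos I z).ne'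
  simp only [← sum_mul_weight, localMoment, Pi.smul_apply, Finset.sum_apply, smul_eq_mul,
    Finset.mul_sum]
  rw [Finset.sum_comm]
  refine Finset.sum_congr rfl fun J _ => Finset.sum_congr rfl fun i _ => ?_
  field_simp

/-- The differential of the pairing of `μ` with `θ`. -/
lemma sum_mul_fderiv_localMoment (I : KSubset n k) (z w : Model n k) (θ : Fin n → ℝ) :
    (∑ J, normSqMinor I J z) * ∑ i, θ i * fderiv ℝ (localMoment I) z w i =
      ∑ J, (indexSum θ J - ∑ i, θ i * localMoment I z i) * fderiv ℝ (normSqMinor I J) z w := by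
  have hJ : ∀ J, HasFDerivAt (normSqMinor I J) (fderiv ℝ (normSqMinor I J) z) z :=
    fun J => (differentiable_normSqMinor I J z).hasFDerivAt
  have hM := hasFDerivAt_pi'.1 (differentiable_localMoment I z).hasFDerivAt
  -- Differentiating the identity with its denominator cleared replaces the quotient rule by the
  -- product rule.
  have h1 := (HasFDerivAt.fun_sum (u := Finset.univ) fun J _ => hJ J).mul
    (HasFDerivAt.fun_sum (u := Finset.univ) fun i _ => (hM i).const_mul (θ i))
  have h2 := HasFDerivAt.fun_sum (u := Finset.univ) fun J _ =>
    (hJ J).mul_const (indexSum θ J)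
  have h3 := h1.unique (h2.congr_of_eventuallyEq
    (Filter.Eventually.of_forall fun z => sum_mul_localMoment I z θ))
  have h4 := congrArg (fun f => f w) h3
  simp only [add_apply, smul_apply,
    sum_apply, ContinuousLinearMap.comp_apply, ContinuousLinearMap.proj_apply,
    smul_eq_mul] at h4
  simp only [sub_mul, Finset.sum_sub_distrib, ← Finset.mul_sum]
  rw [eq_sub_iff_add_eq, h4]

/-- A squared norm has a global minimum wherever it vanishes. -/
lemma fderiv_normSqMinor_eq_zero (I J : KSubset n k) {z : Model n k}
    (h : minor J (chartMatrix I z) = 0) : fderiv ℝ (normSqMinor I J) z = 0 := by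
  apply IsLocalMin.fderiv_eq_zero
  refine Filter.Eventually.of_forall fun w => ?_
  have : normSqMinor I J z = 0 := by simp [normSqMinor, h]
  rw [this]
  exact normSqMinor_nonneg I J w

/-! ### The non-compact flow and the image of the differential of the moment map -/

/-- The element `(e^{θ_1}, …, e^{θ_n})` of the non-compact part of the torus. -/
def realExpTorus (θ : Fin n → ℝ) : AlgTorus n :=
  fun j => Units.mk0 (Real.exp (θ j) : ℂ) (by exact_mod_cast (Real.exp_pos _).ne')

lemma realExpTorus_apply (θ : Fin n → ℝ) (j : Fin n) :
    (realExpTorus θ j : ℂ) = (Real.exp (θ j) : ℝ) := rfl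

lemma torusWeight_realExpTorus (θ : Fin n → ℝ) (J : KSubset n k) :
    torusWeight (realExpTorus θ) J = (Real.exp (indexSum θ J) : ℝ) := by
  simp only [torusWeight_eq, realExpTorus_apply, indexSum, Real.exp_sum, Complex.ofReal_prod]

lemma normSqMinor_twist (I J : KSubset n k) (z : Model n k) (θ : Fin n → ℝ) :
    normSqMinor I J (twist I (realExpTorus θ) z) =
      Real.exp (2 * (indexSum θ J - indexSum θ I)) * normSqMinor I J z := by
  rw [normSqMinor, minor_twist, torusWeight_realExpTorus, torusWeight_realExpTorus, norm_mul,
    mul_pow, normSqMinor]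
  congr 1
  rw [← Complex.ofReal_inv, ← Complex.ofReal_mul, ← Real.exp_neg, ← Real.exp_add,
    Complex.norm_real, Real.norm_eq_abs, abs_of_pos (Real.exp_pos _), ← Real.exp_nat_mul]
  congr 1

/-- The velocity at `s = 0` of `s ↦ e^{sθ} · L` in the chart `M_I`. -/
def gradientField (I : KSubset n k) (θ : Fin n → ℝ) (z : Model n k) : Model n k :=
  fun b j => ((θ (rowEquiv I (Sum.inr b)) - θ (rowEquiv I (Sum.inl j)) : ℝ) : ℂ) * z b j

lemma hasDerivAt_twist_realExpTorus (I : KSubset n k) (θ : Fin n → ℝ) (z : Model n k) :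
    HasDerivAt (fun s : ℝ => twist I (realExpTorus (s • θ)) z) (gradientField I θ z) 0 := by
  refine hasDerivAt_pi.2 fun b => hasDerivAt_pi.2 fun j => ?_
  have h : (fun s : ℝ => twist I (realExpTorus (s • θ)) z b j) = fun s : ℝ =>
      ((Real.exp (s * (θ (rowEquiv I (Sum.inr b)) - θ (rowEquiv I (Sum.inl j)))) : ℝ) : ℂ) *
        z b j := by
    funext s
    rw [twist, realExpTorus_apply, realExpTorus_apply, ← Complex.ofReal_inv, ← Complex.ofReal_mul,
      ← Real.exp_neg, ← Real.exp_add]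
    congr 3
    simp
    ring
  rw [h]
  have h1 := ((hasDerivAt_id (0 : ℝ)).mul_const
    (θ (rowEquiv I (Sum.inr b)) - θ (rowEquiv I (Sum.inl j)))).exp.ofReal_comp.mul_const (z b j)
  simpa [gradientField] using h1

/-- Along the flow, `|P^J|²` is an exact exponential in the time by `normSqMinor_twist`; the chain
rule at time 0 gives its rate, relative to the normalisation `P^I = 1`. -/
lemma fderiv_normSqMinor_gradientField (I J : KSubset n k) (θ : Fin n → ℝ) (z : Model n k) :
    fderiv ℝ (normSqMinor I J) z (gradientField I θ z) =
      2 * (indexSum θ J - indexSum θ I) * normSqMinor I J z := by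
  have h0 : twist I (realExpTorus ((0 : ℝ) • θ)) z = z := by
    funext b j
    simp [twist, realExpTorus_apply]
  have h1 := HasFDerivAt.comp_hasDerivAt (0 : ℝ) (by
    rw [h0]
    exact (differentiable_normSqMinor I J z).hasFDerivAt) (hasDerivAt_twist_realExpTorus I θ z)
  have h2 : normSqMinor I J ∘ (fun s : ℝ => twist I (realExpTorus (s • θ)) z) =
      fun s => Real.exp (s * (2 * (indexSum θ J - indexSum θ I))) * normSqMinor I J z := by
    funext s
    rw [Function.comp_apply, normSqMinor_twist]
    congr 2
    simp only [indexSum, Pi.smul_apply, smul_eq_mul, ← Finset.mul_sum]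
    ring
  rw [h2] at h1
  have h3 := ((hasDerivAt_id (0 : ℝ)).mul_const
    (2 * (indexSum θ J - indexSum θ I))).exp.mul_const (normSqMinor I J z)
  have h4 := h1.unique h3
  rw [h4]
  simp

/-- Exponentiating a compatible `θ` gives a torus element fixing the point; the equality of its
weights becomes additive after taking logarithms. -/
lemma IsCompatible.indexSum_eq {I : KSubset n k} {z : Model n k} {θ : Fin n → ℝ}
    (h : IsCompatible I z θ) (J : KSubset n k) (hJ : minor J (chartMatrix I z) ≠ 0) :
    indexSum θ J = indexSum θ I := by
  have h1 : IsCompatible I z (realExpTorus θ) := fun b j hz => by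
    simp only [realExpTorus, h b j hz]
  have h2 := torusWeight_eq_of_twist_eq h1.twist_eq J hJ
  rw [torusWeight_realExpTorus, torusWeight_realExpTorus] at h2
  exact Real.exp_injective (Complex.ofReal_injective h2)

/-- The vectors orthogonal to the image of the differential of the moment map are the elements
of the Lie algebra of the stabilizer. -/
lemma orthogonal_range_iff (I : KSubset n k) (z : Model n k) (θ : Fin n → ℝ) :
    (∀ w, ∑ i, θ i * fderiv ℝ (localMoment I) z w i = 0) ↔ IsCompatible I z θ := by
  have hpos := sum_normSqMinor_pos I z
  set c := ∑ i, θ i * localMoment I z i with hc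
  -- Here `c` is the mean of `indexSum θ` under the weights `|P^J|²`, so the weighted deviations
  -- cancel.
  have hcsum : ∑ J, normSqMinor I J z * (indexSum θ J - c) = 0 := by
    simp only [mul_sub, Finset.sum_sub_distrib, ← Finset.sum_mul]
    rw [← sum_mul_localMoment, ← hc, sub_self]
  constructor
  · intro h
    have h1 := sum_mul_fderiv_localMoment I z (gradientField I θ z) θ
    rw [h, mul_zero, ← hc] at h1
    simp only [fderiv_normSqMinor_gradientField] at h1
    have h2 : ∑ J, normSqMinor I J z * (indexSum θ J - c) ^ 2 = 0 := by
      -- The flow derivative measures `indexSum θ J` from its value at `I`; recentring at `c` costs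
      -- a multiple of `hcsum`, so what remains is the variance.
      have h3 : ∑ J, normSqMinor I J z * (indexSum θ J - c) ^ 2 =
          (∑ J, (indexSum θ J - c) *
            (2 * (indexSum θ J - indexSum θ I) * normSqMinor I J z)) / 2 +
          (indexSum θ I - c) * ∑ J, normSqMinor I J z * (indexSum θ J - c) := by
        rw [Finset.mul_sum, Finset.sum_div, ← Finset.sum_add_distrib]
        exact Finset.sum_congr rfl fun J _ => by ring
      rw [h3, ← h1, hcsum]
      simp
    have h4 : ∀ J, minor J (chartMatrix I z) ≠ 0 → indexSum θ J = c := by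
      intro J hJ
      have h5 := (Finset.sum_eq_zero_iff_of_nonneg fun J _ =>
        mul_nonneg (normSqMinor_nonneg I J z) (sq_nonneg _)).1 h2 J (Finset.mem_univ _)
      have h6 : normSqMinor I J z ≠ 0 := by simpa [normSqMinor] using hJ
      have h7 := (mul_eq_zero.1 h5).resolve_left h6
      exact sub_eq_zero.1 (pow_eq_zero_iff two_ne_zero |>.1 h7)
    intro b j hz
    obtain ⟨J, hJ, hJ'⟩ := exists_exchange I z hz
    have h8 := h4 J hJ
    rw [← h4 I (by rw [minor_chartMatrix]; exact one_ne_zero), indexSum, hJ', sum_exchange,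
      indexSum] at h8
    linarith
  · intro h w
    have h1 := sum_mul_fderiv_localMoment I z w θ
    -- All index sets of positive weight share the value at `I`, so the mean equals it.
    have h2 : indexSum θ I = c := by
      have h3 : ∑ J, normSqMinor I J z * (indexSum θ J - c) =
          (∑ J, normSqMinor I J z) * (indexSum θ I - c) := by
        rw [Finset.sum_mul]
        refine Finset.sum_congr rfl fun J _ => ?_
        by_cases hJ : minor J (chartMatrix I z) = 0
        · simp [normSqMinor, hJ]
        · rw [h.indexSum_eq J hJ]
      rw [hcsum] at h3
      exact sub_eq_zero.1 ((mul_eq_zero.1 h3.symm).resolve_left hpos.ne')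
    have h4 : ∑ J, (indexSum θ J - c) * fderiv ℝ (normSqMinor I J) z w = 0 := by
      refine Finset.sum_eq_zero fun J _ => ?_
      by_cases hJ : minor J (chartMatrix I z) = 0
      · simp [fderiv_normSqMinor_eq_zero I J hJ]
      · rw [h.indexSum_eq J hJ, h2, sub_self, zero_mul]
    rw [← hc, h4] at h1
    exact (mul_eq_zero.1 h1).resolve_left hpos.ne'

/-! ### Regular points of the moment map -/

lemma hasMFDerivAt_momentMap (L : Gr n k) :
    HasMFDerivAt 𝓘(ℝ, Model n k) 𝓘(ℝ, Fin n → ℝ) (momentMap : Gr n k → Fin n → ℝ) L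
      (fderiv ℝ (localMoment (chartIndex L)) (localCoords L)) := by
  refine ⟨?_, ?_⟩
  · have hs := (chartAt (Model n k) L).open_source.mem_nhds (mem_chart_source _ L)
    have hc := (chartAt (Model n k) L).continuousAt (mem_chart_source _ L)
    have h1 : ContinuousAt (localMoment (chartIndex L) ∘ chartAt (Model n k) L) L :=
      (differentiable_localMoment _).continuous.continuousAt.comp hc
    refine h1.congr (Filter.eventually_of_mem hs fun L' hL' => ?_)
    change localMoment (chartIndex L) (coords (chartIndex L) (frame L')) = momentMap L'
    rw [← momentMap_chartInv, exists_chartInv_eq (I := chartIndex L) hL']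
  · have hw : writtenInExtChartAt 𝓘(ℝ, Model n k) 𝓘(ℝ, Fin n → ℝ) L
        (momentMap : Gr n k → Fin n → ℝ) = localMoment (chartIndex L) := by
      funext z
      exact momentMap_chartInv (chartIndex L) z
    rw [hw]
    exact (differentiable_localMoment _ _).hasFDerivAt.hasFDerivWithinAt

/-- The constant vector is always compatible, hence orthogonal to the image by
`orthogonal_range_iff`. -/
lemma range_fderiv_localMoment_le (I : KSubset n k) (z : Model n k) :
    LinearMap.range (fderiv ℝ (localMoment I) z).toLinearMap ≤ sumZero n := by
  rintro _ ⟨w, rfl⟩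
  have h := (orthogonal_range_iff I z fun _ => 1).2 (fun _ _ _ => rfl) w
  simpa [mem_sumZero] using h

lemma isRegularPoint_iff (hk : 0 < k) (hkn : k < n) (L : Gr n k) :
    IsRegularPoint L ↔ IsConnected (chartIndex L) (localCoords L) := by
  have hm := hasMFDerivAt_momentMap L
  have h := eq_sumZero_iff
    (range_fderiv_localMoment_le (chartIndex L) (localCoords L))
  rw [IsRegularPoint, hm.mfderiv, and_iff_right hm.mdifferentiableAt,
    vectorSpan_hypersimplex hk hkn]
  refine h.trans (forall_congr' fun θ => ?_)
  rw [← orthogonal_range_iff]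
  simp only [LinearMap.mem_range, forall_exists_index, forall_apply_eq_imp_iff]
  rfl

end TorusGrassmann

end

theorem mainTheorem8 (n k : ℕ) (hk : 0 < k) (hkn : k < n) (x : Fin n → ℝ)
    (hx : x ∈ intrinsicInterior ℝ (TorusGrassmann.hypersimplex n k)) :
    (TorusGrassmann.IsRegularValue n k x ↔
      ∀ σ : Set (TorusGrassmann.KSubset n k), TorusGrassmann.IsAdmissible σ →
        TorusGrassmann.stationarySubgroup σ ≠ ⊥ →
          (TorusGrassmann.momentMap ⁻¹' {x}) ∩ TorusGrassmann.stratum σ = ∅) ∧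
    (TorusGrassmann.IsRegularValue n k x ↔
      ∀ L : TorusGrassmann.Gr n k, L ∈ TorusGrassmann.momentMap ⁻¹' {x} →
        TorusGrassmann.defect L = 0) := by
  open TorusGrassmann in
  have hn : 0 < n := hk.trans hkn
  have hstratum : ∀ {σ : Set (KSubset n k)} {L : Gr n k}, L ∈ stratum σ →
      (stationarySubgroup σ = ⊥ ↔ IsRegularPoint L) := by
    intro σ L hL
    rw [isRegularPoint_iff hk hkn]
    exact stationarySubgroup_eq_bot_iff hn (by rwa [chartInv_localCoords])
  refine ⟨⟨fun h σ _ hσ => ?_, fun h L hL => ?_⟩, ?_⟩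
  · refine Set.eq_empty_of_forall_notMem fun L hL => hσ ?_
    exact (hstratum hL.2).2 (h L hL.1)
  · by_contra hreg
    -- Every point lies in the stratum cut out by its own non-zero Plücker coordinates, so a
    -- non-regular point puts a stratum with non-trivial stationary subgroup in contact with the
    -- fibre.
    have hmem : L ∈ stratum {I | plucker L I ≠ 0} := fun I => Iff.rfl
    have h1 := h _ ⟨L, hmem⟩ fun hbot => hreg ((hstratum hmem).1 hbot)
    exact Set.notMem_empty L (h1 ▸ ⟨hL, hmem⟩)
  · refine forall_congr' fun L => imp_congr Iff.rfl ?_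
    rw [isRegularPoint_iff hk hkn, defect_eq_zero_iff hn]
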